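/- Let $\mathcal X$ be a compact metric space (for example a compact subset of $\mathbb R^d$, $d\ge 1$), let $k:\mathcal X\times\mathcal X\to\mathbb R$ be a continuous positive semidefinite kernel with reproducing kernel Hilbert space $\mathcal H$, and write $k_x=k(x,\cdot)\in\mathcal H$. For a Borel probability measure $\mathbb P$ on $\mathcal X$ put $$m_{\mathbb P}=\int k_x\,d\mathbb P(x)\in\mathcal H,\qquad S_{\mathbb P}=\int k_x\otimes k_x\,d\mathbb P(x):\mathcal H\to\mathcal H .$$ Let $\mathbb P,\mathbb Q$ be Borel probability measures on $\mathcal X$, $\Gamma=\tfrac12(\mathbb P+\mathbb Q)$ and $\bar S=\tfrac12(S_{\mathbb P}+S_{\mathbb Q})$. Assume that $k$ is $L^2(\mathcal X,\Gamma)$-universal: for every continuous $g:\mathcal X\to\mathbb R$ and $\varepsilon>0$ there is $f\in\mathcal H$ with $\|f-g\|_{L^2(\Gamma)}<\varepsilon$ (this holds in particular if $\mathcal H$ is uniformly dense in $C(\mathcal X)$). Then the Gaussian measures $\mathcal N(m_{\mathbb P},\bar S)$ and $\mathcal N(m_{\mathbb Q},\bar S)$ on $\mathcal H$ with means $m_{\mathbb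 P},m_{\mathbb Q}$ and covariance operator $\bar S$ exist, $\bar S$ has a non-negative square root $\bar S^{1/2}$, and: 1. $\mathcal N(m_{\mathbb P},\bar S)$ and $\mathcal N(m_{\mathbb Q},\bar S)$ are equivalent (mutually absolutely continuous) if and only if $\frac{d\mathbb P}{d\Gamma}-\frac{d\mathbb Q}{d\Gamma}\in L^2(\mathcal X,\Gamma)$. 2. In $[0,\infty]$, $$\bigl\|\bar S^{-1/2}(m_{\mathbb P}-m_{\mathbb Q})\bigr\|_{\mathcal H}=\Bigl\|\frac{d\mathbb P}{d\Gamma}-\frac{d\mathbb Q}{d\Gamma}\Bigr\|_{L^2(\mathcal X,\Gamma)},$$ where $\bar S^{-1/2}x$ denotes the vector $u\in(\ker\bar S^{1/2})^{\perp}$ with $\bar S^{1/2}u=x$, and $\|\bar S^{-1/2}x\|_{\mathcal H}=\infty$ if $x$ is not in the range of $\bar S^{1/2}$. 3. The mean component alone does not produce singularity: whatever $\mathbb P$ and $\mathbb Q$ are (in particular also when $\mathbb P\ne\mathbb Q$), $\mathcal N(m_{\mathbb P},\bar S)$ and $\mathcal N(m_{\mathbb Q},\bar S)$ are not mutually singular.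 -/

import Mathlib

open MeasureTheory ProbabilityTheory InnerProductSpace
open scoped ENNReal RealInnerProductSpace

namespace KernelGaussian

noncomputable section

section Embeddings

variable {X : Type*} [MeasurableSpace X]
variable (H : Type*) [NormedAddCommGroup H] [InnerProductSpace ℝ H] [CompleteSpace H]
  [RKHS ℝ H X ℝ]

/-- The feature vector `k_x = k(x, ·) ∈ H` of a reproducing kernel Hilbert space `H` of
real-valued functions on `X`; it satisfies `⟪f, k_x⟫ = f x`. -/
def feature (x : X) : H := RKHS.kerFun H x (1 : ℝ)

/-- The kernel mean embedding `m_P = ∫ k_x dP(x)`. -/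
def meanEmbedding (P : Measure X) : H := ∫ x, feature H x ∂P

/-- The (uncentred) kernel covariance embedding `S_P = ∫ k_x ⊗ k_x dP(x)`, a Bochner integral
in the space of bounded operators on `H`. -/
def covEmbedding (P : Measure X) : H →L[ℝ] H :=
  ∫ x, rankOne ℝ (feature H x) (feature H x) ∂P

/-- `L²(X, μ)`-universality: the functions of the reproducing kernel Hilbert space approximate
every continuous function on `X` arbitrarily well in the distance of `L²(X, μ)`. -/
def IsL2Universal [TopologicalSpace X] (μ : Measure X) : Prop :=
  ∀ g : C(X, ℝ), ∀ ε : ℝ≥0∞, 0 < ε → ∃ f : H, eLpNorm (fun x => f x - g x) 2 μ < ε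

end Embeddings

section Gaussian

variable {H : Type*} [NormedAddCommGroup H] [InnerProductSpace ℝ H]
  [MeasurableSpace H] [BorelSpace H]

/-- `μ` is a Gaussian measure on `H` (every `⟪f, ·⟫` is a real Gaussian variable under `μ`) with
mean vector `m` and covariance operator `S`. -/
structure IsGaussianWith (μ : Measure H) (m : H) (S : H →L[ℝ] H) : Prop where
  isGaussian : IsGaussian μ
  mean : ∫ u, u ∂μ = m
  cov : ∀ f g : H, covarianceBilin μ f g = ⟪f, S g⟫

open Classical in
/-- The Gaussian measure `N(m, S)` on `H` (the zero measure if there is none). -/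
def gaussianMeasure (m : H) (S : H →L[ℝ] H) : Measure H :=
  if h : ∃ μ : Measure H, IsGaussianWith μ m S then h.choose else 0

/-- A Gaussian measure on a separable Hilbert space is determined by its mean vector and its
covariance operator. -/
theorem IsGaussianWith.unique [CompleteSpace H] [SecondCountableTopology H] {μ ν : Measure H}
    {m : H} {S : H →L[ℝ] H} (hμ : IsGaussianWith μ m S) (hν : IsGaussianWith ν m S) : μ = ν := by
  have h1 := hμ.isGaussian
  have h2 := hν.isGaussian
  refine IsGaussian.ext (hμ.mean.trans hν.mean.symm) ?_
  ext f g
  rw [hμ.cov, hν.cov]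

end Gaussian

section Mahalanobis

variable {H : Type*} [NormedAddCommGroup H] [InnerProductSpace ℝ H] [CompleteSpace H]

/-- `R` is a non-negative square root of the operator `S`. -/
def IsNonnegSqrt (R S : H →L[ℝ] H) : Prop := R.IsPositive ∧ R ∘L R = S

open Classical in
/-- The non-negative square root `S^{1/2}` of a non-negative operator `S`
(zero if there is none). -/
def opSqrt (S : H →L[ℝ] H) : H →L[ℝ] H :=
  if h : ∃ R : H →L[ℝ] H, IsNonnegSqrt R S then h.choose else 0

/-- The Mahalanobis norm `‖S^{-1/2} x‖ ∈ [0, ∞]`. Here `S^{-1/2} x` is the (unique, if any)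
vector `u` orthogonal to the null space of `S^{1/2}` with `S^{1/2} u = x`; the value is `∞` if `x`
is not in the range of `S^{1/2}`. -/
def mahalanobisNorm (S : H →L[ℝ] H) (x : H) : ℝ≥0∞ :=
  ⨅ u : H, ⨅ _ : u ∈ (LinearMap.ker (opSqrt S).toLinearMap)ᗮ ∧ opSqrt S u = x, ‖u‖ₑ

end Mahalanobis

/-- The mixture `(P + Q) / 2`. -/
def mixture {X : Type*} [MeasurableSpace X] (P Q : Measure X) : Measure X :=
  (2⁻¹ : ℝ≥0∞) • (P + Q)

/-- The difference `dP/dΓ - dQ/dΓ` of Radon-Nikodym derivatives. -/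
def densityDiff {X : Type*} [MeasurableSpace X] (P Q Γ : Measure X) (x : X) : ℝ :=
  (P.rnDeriv Γ x).toReal - (Q.rnDeriv Γ x).toReal

/-- The averaged covariance embedding `(S_P + S_Q) / 2`. -/
def avgCov {X : Type*} [MeasurableSpace X] (H : Type*) [NormedAddCommGroup H]
    [InnerProductSpace ℝ H] [CompleteSpace H] [RKHS ℝ H X ℝ] (P Q : Measure X) : H →L[ℝ] H :=
  (2⁻¹ : ℝ) • (covEmbedding H P + covEmbedding H Q)

end

end KernelGaussian

/-!
Write `Γ` for the mixture `(P + Q) / 2`, `A : H → L²(Γ)` for the inclusion of the reproducing kernel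
Hilbert space and `h = dP/dΓ - dQ/dΓ`. By the reproducing property `S̄ = A† A`
(`avgCov_eq_adjoint_comp_toL2`) and `m_P - m_Q = A† h` (`meanEmbedding_sub_eq_adjoint`). As `P` and
`Q` are at most `2 Γ`, both densities are bounded by `2`, so `h` always lies in `L²(Γ)`
(`memLp_densityDiff`). Hence both sides of the equivalence criterion hold for all `P` and `Q`, and
the absence of singularity is a consequence.

*Square root and Mahalanobis norm.* `1 - T` has for a self-adjoint contraction `T` the square
root `1 - T C / 2` with `C = ∑ Cₙ (T / 4)ⁿ` the generating function of the Catalan numbers; scaling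
gives `R = S̄^{1/2}` (`exists_isNonnegSqrt_adjoint_comp_self`). Since `‖R f‖ = ‖A f‖` and `A` has
dense range by universality, the limit `u` of `R fₙ` along `A fₙ → h` is orthogonal to the kernel
of `R` and satisfies `R u = A† h` and `‖u‖ = ‖h‖` (`IsNonnegSqrt.exists_apply_eq_adjoint`).

*Gaussian measures.* `R` is Hilbert-Schmidt, because
`∑ ‖R eᵢ‖² = ∑ ∫ ⟪eᵢ, k_x⟫² dΓ ≤ ∫ ‖k_x‖² dΓ`. For a Hilbert-Schmidt operator `B` the series
`∑ ξᵢ B eᵢ` with independent standard Gaussian `ξᵢ` converges in `L²`, and its law is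
`N(0, B B†)` (`exists_isGaussianWith_comp_adjoint`).

*Equivalence.* The shift `m_P - m_Q = R u` lies in the range of `S̄^{1/2}`. With `u = ‖u‖ e`
and `w = R e`, the measure `N(m + c w, S̄)` is the image of `N(c, 1) ⊗ N(0, S̄ - w ⊗ w)` under
`(t, y) ↦ m + t w + y`. Real Gaussian measures of variance `1` are equivalent, hence so are these
images for all `c` (`gaussianMeasure_absolutelyContinuous_of_sub_eq`).
-/

namespace KernelGaussian

/-! ### The Catalan series -/

/-- With `bₙ = centralBinom n / 4ⁿ` the terms telescope, as `Cₙ / 4ⁿ = 2 (bₙ - bₙ₊₁)`. -/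
theorem sum_catalan_mul_inv_four_pow (n : ℕ) :
    ∑ i ∈ Finset.range n, (catalan i : ℝ) * (4⁻¹) ^ i = 2 - 2 * (n.centralBinom * (4⁻¹) ^ n) := by
  induction n with
  | zero => simp
  | succ n ih =>
    have h1 : ((n : ℝ) + 1) * catalan n = n.centralBinom := by
      exact_mod_cast succ_mul_catalan_eq_centralBinom n
    have h2 : ((n : ℝ) + 1) * (n + 1).centralBinom = 2 * (2 * n + 1) * n.centralBinom := by
      exact_mod_cast Nat.succ_mul_centralBinom_succ n
    have hn : (n : ℝ) + 1 ≠ 0 := by positivity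
    have h3 : ((n + 1).centralBinom : ℝ) = 2 * (2 * n + 1) * catalan n := by
      apply mul_left_cancel₀ hn
      rw [h2, ← h1]; ring
    rw [Finset.sum_range_succ, ih, h3, ← h1, pow_succ]
    ring

theorem sum_catalan_mul_inv_four_pow_le (n : ℕ) :
    ∑ i ∈ Finset.range n, (catalan i : ℝ) * (4⁻¹) ^ i ≤ 2 := by
  rw [sum_catalan_mul_inv_four_pow]
  have : (0 : ℝ) ≤ n.centralBinom * (4⁻¹) ^ n := by positivity
  linarith

theorem summable_catalan_mul_inv_four_pow :
    Summable fun i : ℕ => (catalan i : ℝ) * (4⁻¹) ^ i :=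
  summable_of_sum_range_le (fun _ => by positivity) sum_catalan_mul_inv_four_pow_le

theorem tsum_catalan_mul_inv_four_pow_le :
    ∑' i : ℕ, (catalan i : ℝ) * (4⁻¹) ^ i ≤ 2 :=
  Real.tsum_le_of_sum_range_le (fun _ => by positivity) sum_catalan_mul_inv_four_pow_le

section BanachAlgebra

variable {𝔸 : Type*} [NormedRing 𝔸] [NormedAlgebra ℝ 𝔸]

/-- The generating function `∑ Cₙ (a / 4)ⁿ` of the Catalan numbers. For `‖a‖ ≤ 1` the value
`1 - a * catalanSeries a / 2` is a square root of `1 - a`. -/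
noncomputable def catalanSeries (a : 𝔸) : 𝔸 := ∑' n : ℕ, (catalan n : ℝ) • ((4⁻¹ : ℝ) • a) ^ n

theorem norm_catalan_smul_pow_le [NormOneClass 𝔸] {a : 𝔸} (ha : ‖a‖ ≤ 1) (n : ℕ) :
    ‖(catalan n : ℝ) • ((4⁻¹ : ℝ) • a) ^ n‖ ≤ (catalan n : ℝ) * (4⁻¹) ^ n := by
  rw [norm_smul, Real.norm_natCast]
  gcongr
  refine (norm_pow_le _ n).trans ?_
  gcongr
  rw [norm_smul]
  norm_num
  linarith

theorem summable_norm_catalanSeries [NormOneClass 𝔸] {a : 𝔸} (ha : ‖a‖ ≤ 1) :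
    Summable fun n : ℕ => ‖(catalan n : ℝ) • ((4⁻¹ : ℝ) • a) ^ n‖ :=
  .of_nonneg_of_le (fun _ => norm_nonneg _) (norm_catalan_smul_pow_le ha)
    summable_catalan_mul_inv_four_pow

theorem norm_catalanSeries_le [NormOneClass 𝔸] {a : 𝔸} (ha : ‖a‖ ≤ 1) :
    ‖catalanSeries a‖ ≤ 2 :=
  (tsum_of_norm_bounded summable_catalan_mul_inv_four_pow.hasSum
    (norm_catalan_smul_pow_le ha)).trans tsum_catalan_mul_inv_four_pow_le

theorem commute_catalanSeries (a : 𝔸) : Commute a (catalanSeries a) :=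
  Commute.tsum_right _ fun n =>
    (((Commute.refl a).smul_right _).pow_right n).smul_right _

variable [CompleteSpace 𝔸]

/-- The recursion of the Catalan numbers as a quadratic equation for their generating function. -/
theorem catalanSeries_eq [NormOneClass 𝔸] {a : 𝔸} (ha : ‖a‖ ≤ 1) :
    catalanSeries a = 1 + (4⁻¹ : ℝ) • a * (catalanSeries a * catalanSeries a) := by
  have hs := summable_norm_catalanSeries ha
  have hmul := tsum_mul_tsum_eq_tsum_sum_antidiagonal_of_summable_norm hs hs
  have hterm : ∀ n : ℕ, ∑ p ∈ Finset.HasAntidiagonal.antidiagonal n,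
      ((catalan p.1 : ℝ) • ((4⁻¹ : ℝ) • a) ^ p.1) * ((catalan p.2 : ℝ) • ((4⁻¹ : ℝ) • a) ^ p.2)
      = (catalan (n + 1) : ℝ) • ((4⁻¹ : ℝ) • a) ^ n := by
    intro n
    rw [catalan_succ', Nat.cast_sum, Finset.sum_smul]
    refine Finset.sum_congr rfl fun p hp => ?_
    rw [smul_mul_smul_comm, ← pow_add, Finset.HasAntidiagonal.mem_antidiagonal.1 hp, Nat.cast_mul]
  simp_rw [hterm] at hmul
  have hs' : Summable fun n : ℕ => (catalan (n + 1) : ℝ) • ((4⁻¹ : ℝ) • a) ^ n := by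
    have := (summable_norm_sum_mul_antidiagonal_of_summable_norm hs hs).of_norm
    simpa only [hterm] using this
  rw [catalanSeries, hmul, hs.of_norm.tsum_eq_zero_add, ← hs'.tsum_mul_left]
  congr 1
  · simp
  · refine tsum_congr fun n => ?_
    rw [mul_smul_comm, pow_succ']

theorem sq_one_sub_mul_catalanSeries [NormOneClass 𝔸] {a : 𝔸} (ha : ‖a‖ ≤ 1) :
    (1 - (2⁻¹ : ℝ) • (a * catalanSeries a)) * (1 - (2⁻¹ : ℝ) • (a * catalanSeries a)) = 1 - a := by
  have hc : catalanSeries a * a = a * catalanSeries a := (commute_catalanSeries a).eq.symm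
  have key : a * catalanSeries a * (a * catalanSeries a)
      = (4 : ℝ) • (a * catalanSeries a - a) := by
    have h := congrArg (fun x => a * x) (catalanSeries_eq ha)
    simp only [mul_add, mul_one, smul_mul_assoc, mul_smul_comm] at h
    have h2 : a * catalanSeries a * (a * catalanSeries a)
        = a * (a * (catalanSeries a * catalanSeries a)) := by
      simp only [mul_assoc]
      rw [← mul_assoc (catalanSeries a) a, hc]
      simp only [mul_assoc]
    rw [h2, h, add_sub_cancel_left, smul_smul]
    norm_num
  rw [sub_mul, mul_sub, mul_sub, smul_mul_smul_comm, key, smul_smul]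
  simp only [one_mul, mul_one]
  module

end BanachAlgebra

/-! ### Square roots of operators and the Mahalanobis norm -/

section Operator

variable {H K : Type*} [NormedAddCommGroup H] [InnerProductSpace ℝ H] [CompleteSpace H]
  [NormedAddCommGroup K] [InnerProductSpace ℝ K] [CompleteSpace K]

theorem isSelfAdjoint_catalanSeries {T : H →L[ℝ] H} (hT : IsSelfAdjoint T) :
    IsSelfAdjoint (catalanSeries T) := by
  rw [IsSelfAdjoint, catalanSeries, tsum_star]
  refine tsum_congr fun n => ?_
  rw [star_smul, star_pow, star_smul, hT.star_eq]
  simp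

theorem exists_isNonnegSqrt_one_sub [Nontrivial H] {T : H →L[ℝ] H} (hT : IsSelfAdjoint T)
    (hT1 : ‖T‖ ≤ 1) : ∃ R, IsNonnegSqrt R (1 - T) := by
  refine ⟨1 - (2⁻¹ : ℝ) • (T * catalanSeries T), ?_, sq_one_sub_mul_catalanSeries hT1⟩
  rw [ContinuousLinearMap.isPositive_def]
  constructor
  · rw [← ContinuousLinearMap.isSelfAdjoint_iff_isSymmetric]
    refine (IsSelfAdjoint.one _).sub (IsSelfAdjoint.smul (IsSelfAdjoint.all _) ?_)
    exact (hT.commute_iff (isSelfAdjoint_catalanSeries hT)).1 (commute_catalanSeries T)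
  · intro x
    have h1 : ‖(2⁻¹ : ℝ) • (T * catalanSeries T)‖ ≤ 1 := by
      rw [norm_smul]
      have := (norm_mul_le T (catalanSeries T)).trans
        (mul_le_mul hT1 (norm_catalanSeries_le hT1) (norm_nonneg _) zero_le_one)
      norm_num
      linarith
    have h2 : ⟪((2⁻¹ : ℝ) • (T * catalanSeries T)) x, x⟫ ≤ ‖x‖ * ‖x‖ :=
      (real_inner_le_norm _ _).trans
        (mul_le_mul_of_nonneg_right (ContinuousLinearMap.le_of_opNorm_le _ h1 x |>.trans
          (one_mul _).le) (norm_nonneg _))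
    rw [ContinuousLinearMap.reApplyInnerSelf_apply, sub_apply,
      inner_sub_left, one_apply_eq_self, real_inner_self_eq_norm_mul_norm]
    simpa using h2

/-- The operator `A† A` has a non-negative square root: for `c > ‖A‖²` the operator
`1 - c⁻¹ A† A` is a self-adjoint contraction, and the Catalan series applies to it. -/
theorem exists_isNonnegSqrt_adjoint_comp_self (A : H →L[ℝ] K) :
    ∃ R, IsNonnegSqrt R (A.adjoint ∘L A) := by
  rcases subsingleton_or_nontrivial H with hH | hH
  · exact ⟨0, ContinuousLinearMap.isPositive_zero, by ext x; exact Subsingleton.elim _ _⟩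
  set S := A.adjoint ∘L A with hS
  set c : ℝ := ‖A‖ ^ 2 + 1 with hc
  have hc0 : 0 < c := by positivity
  have hSa : IsSelfAdjoint S := (ContinuousLinearMap.isPositive_adjoint_comp_self A).isSelfAdjoint
  have hin : ∀ x, ⟪S x, x⟫ = ‖A x‖ ^ 2 := fun x => by
    rw [hS, ContinuousLinearMap.comp_apply, ContinuousLinearMap.adjoint_inner_left,
      real_inner_self_eq_norm_sq]
  have hT1 : ‖1 - c⁻¹ • S‖ ≤ 1 := by
    refine ContinuousLinearMap.opNorm_le_bound _ zero_le_one fun x => ?_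
    rw [one_mul]
    refine le_of_sq_le_sq ?_ (norm_nonneg _)
    have h1 : ‖S x‖ ^ 2 ≤ c * ‖A x‖ ^ 2 := by
      have : ‖S x‖ ≤ ‖A‖ * ‖A x‖ := by
        rw [hS, ContinuousLinearMap.comp_apply]
        simpa using A.adjoint.le_opNorm (A x)
      calc ‖S x‖ ^ 2 ≤ (‖A‖ * ‖A x‖) ^ 2 := by gcongr
        _ ≤ c * ‖A x‖ ^ 2 := by rw [hc]; nlinarith [sq_nonneg ‖A x‖]
    have h2 : (1 - c⁻¹ • S) x = x - c⁻¹ • S x := rfl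
    rw [h2, norm_sub_sq_real, inner_smul_right, real_inner_comm, hin, norm_smul, mul_pow]
    have h3 : ‖c⁻¹‖ ^ 2 * ‖S x‖ ^ 2 ≤ c⁻¹ * ‖A x‖ ^ 2 := by
      rw [Real.norm_eq_abs, sq_abs]
      calc c⁻¹ ^ 2 * ‖S x‖ ^ 2 ≤ c⁻¹ ^ 2 * (c * ‖A x‖ ^ 2) := by gcongr
        _ = c⁻¹ * ‖A x‖ ^ 2 := by field_simp
    have h4 : 0 ≤ c⁻¹ * ‖A x‖ ^ 2 := by positivity
    linarith
  obtain ⟨R, hR, hRR⟩ := exists_isNonnegSqrt_one_sub (T := 1 - c⁻¹ • S)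
    ((IsSelfAdjoint.one _).sub (IsSelfAdjoint.smul (IsSelfAdjoint.all _) hSa)) hT1
  refine ⟨Real.sqrt c • R, hR.smul_of_nonneg (Real.sqrt_nonneg c), ?_⟩
  have : (Real.sqrt c • R) ∘L (Real.sqrt c • R) = c • (R ∘L R) := by
    rw [ContinuousLinearMap.smul_comp, ContinuousLinearMap.comp_smul, smul_smul,
      Real.mul_self_sqrt hc0.le]
  rw [this, hRR, sub_sub_cancel, smul_smul, mul_inv_cancel₀ hc0.ne', one_smul]

omit [CompleteSpace H] in
theorem isNonnegSqrt_opSqrt {S : H →L[ℝ] H} (h : ∃ R, IsNonnegSqrt R S) :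
    IsNonnegSqrt (opSqrt S) S := by
  rw [opSqrt, dif_pos h]
  exact h.choose_spec

theorem IsNonnegSqrt.norm_apply {R : H →L[ℝ] H} {A : H →L[ℝ] K}
    (hR : IsNonnegSqrt R (A.adjoint ∘L A)) (x : H) : ‖R x‖ = ‖A x‖ := by
  have h : ‖R x‖ ^ 2 = ‖A x‖ ^ 2 := by
    rw [← real_inner_self_eq_norm_sq, ← real_inner_self_eq_norm_sq,
      hR.1.inner_left_eq_inner_right, ← ContinuousLinearMap.comp_apply, hR.2,
      ContinuousLinearMap.comp_apply, ContinuousLinearMap.adjoint_inner_right]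
  exact (sq_eq_sq₀ (norm_nonneg _) (norm_nonneg _)).1 h

/-- If `R` is a square root of `A† A` and `A` has dense range, then `A† h` is the image under `R`
of a vector of norm `‖h‖` orthogonal to the kernel of `R`. This vector is the limit of `R fₙ` for
any sequence with `A fₙ → h`, as `‖R f‖ = ‖A f‖` for all `f`. -/
theorem IsNonnegSqrt.exists_apply_eq_adjoint {R : H →L[ℝ] H} {A : H →L[ℝ] K}
    (hR : IsNonnegSqrt R (A.adjoint ∘L A)) (hA : DenseRange A) (h : K) :
    ∃ u : H, u ∈ (LinearMap.ker R.toLinearMap)ᗮ ∧ R u = A.adjoint h ∧ ‖u‖ = ‖h‖ := by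
  obtain ⟨y, hy, hlim⟩ := mem_closure_iff_seq_limit.1 (hA h)
  choose f hf using hy
  have hAf : Filter.Tendsto (fun n => A (f n)) Filter.atTop (nhds h) := by
    simpa only [hf] using hlim
  have hcauchy : CauchySeq fun n => R (f n) := by
    have hc := hAf.cauchySeq
    rw [Metric.cauchySeq_iff] at hc ⊢
    intro ε hε
    obtain ⟨N, hN⟩ := hc ε hε
    refine ⟨N, fun m hm n hn => ?_⟩
    rw [dist_eq_norm, ← map_sub, hR.norm_apply, map_sub, ← dist_eq_norm]
    exact hN m hm n hn
  obtain ⟨u, hu⟩ := cauchySeq_tendsto_of_complete hcauchy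
  refine ⟨u, ?_, ?_, ?_⟩
  · refine (Submodule.isClosed_orthogonal _).mem_of_tendsto hu (.of_forall fun n => ?_)
    rw [SetLike.mem_coe, Submodule.mem_orthogonal]
    intro v hv
    rw [← hR.1.inner_left_eq_inner_right, show R v = 0 from hv, inner_zero_left]
  · refine tendsto_nhds_unique ((R.continuous.tendsto u).comp hu) ?_
    refine ((A.adjoint.continuous.tendsto h).comp hAf).congr fun n => ?_
    exact (congrArg (fun T : H →L[ℝ] H => T (f n)) hR.2).symm
  · refine tendsto_nhds_unique hu.norm (hAf.norm.congr fun n => (hR.norm_apply _).symm)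

omit [CompleteSpace H] in
theorem mahalanobisNorm_eq {S : H →L[ℝ] H} {x u : H}
    (hu : u ∈ (LinearMap.ker (opSqrt S).toLinearMap)ᗮ) (hux : opSqrt S u = x) :
    mahalanobisNorm S x = ‖u‖ₑ := by
  refine le_antisymm (iInf₂_le u ⟨hu, hux⟩) (le_iInf₂ fun w hw => ?_)
  have h1 : u - w ∈ (LinearMap.ker (opSqrt S).toLinearMap)ᗮ := Submodule.sub_mem _ hu hw.1
  have h2 : u - w ∈ LinearMap.ker (opSqrt S).toLinearMap := by
    rw [LinearMap.mem_ker]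
    simp [hux, hw.2]
  rw [sub_eq_zero.1 (inner_self_eq_zero.1 (h1 _ h2) : u - w = 0)]

end Operator

/-! ### Feature vectors of a reproducing kernel Hilbert space -/

section Feature

variable {X : Type*} {H : Type*} [NormedAddCommGroup H] [InnerProductSpace ℝ H] [CompleteSpace H]
  [RKHS ℝ H X ℝ]

theorem inner_feature (f : H) (x : X) : ⟪f, feature H x⟫ = f x := by
  rw [feature, RKHS.inner_kerFun]
  simp

theorem inner_feature_left (f : H) (x : X) : ⟪feature H x, f⟫ = f x := by
  rw [real_inner_comm, inner_feature]

theorem continuous_feature [TopologicalSpace X] {k : X → X → ℝ}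
    (hk : Continuous fun p : X × X => k p.1 p.2) (hH : ∀ x y : X, feature H y x = k x y) :
    Continuous (feature H : X → H) := by
  have hdist : ∀ x y : X, ‖feature H x - feature H y‖ ^ 2 = k x x - 2 * k y x + k y y := by
    intro x y
    rw [norm_sub_sq_real, ← real_inner_self_eq_norm_sq, ← real_inner_self_eq_norm_sq]
    simp only [inner_feature, hH]
  rw [continuous_iff_continuousAt]
  intro y
  rw [ContinuousAt, tendsto_iff_norm_sub_tendsto_zero]
  have h1 : Filter.Tendsto (fun x => Real.sqrt (k x x - 2 * k y x + k y y)) (nhds y) (nhds 0) := by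
    have hc : Continuous fun x => Real.sqrt (k x x - 2 * k y x + k y y) := by
      have ha : Continuous fun x => k x x := hk.comp (continuous_id.prodMk continuous_id)
      have hb : Continuous fun x => k y x := hk.comp (continuous_const.prodMk continuous_id)
      fun_prop
    have := hc.tendsto y
    rwa [show k y y - 2 * k y y + k y y = 0 by ring, Real.sqrt_zero] at this
  refine h1.congr fun x => ?_
  rw [← hdist, Real.sqrt_sq (norm_nonneg _)]

theorem separableSpace_of_continuous_feature [TopologicalSpace X]
    [TopologicalSpace.SeparableSpace X]
    (hc : Continuous (feature H : X → H)) : TopologicalSpace.SeparableSpace H := by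
  have h1 : TopologicalSpace.IsSeparable (Set.range (feature H : X → H)) :=
    TopologicalSpace.isSeparable_range hc
  have h2 := (h1.span (R := ℝ)).closure
  have h3 : closure (Submodule.span ℝ (Set.range (feature H : X → H)) : Set H) = Set.univ := by
    rw [← Submodule.topologicalClosure_coe]
    have hd := RKHS.kerFun_dense (𝕜 := ℝ) (X := X) (V := ℝ) H
    have hle : Submodule.span ℝ {RKHS.kerFun H x v | (x : X) (v : ℝ)} ≤
        Submodule.span ℝ (Set.range (feature H : X → H)) := by
      rw [Submodule.span_le]
      rintro _ ⟨x, v, rfl⟩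
      have : RKHS.kerFun H x v = v • feature H x := by
        rw [feature, ← map_smul, smul_eq_mul, mul_one]
      rw [this]
      exact Submodule.smul_mem _ _ (Submodule.subset_span ⟨x, rfl⟩)
    have := Submodule.topologicalClosure_mono hle
    rw [hd, top_le_iff] at this
    rw [this, Submodule.top_coe]
  rw [h3] at h2
  exact TopologicalSpace.isSeparable_univ_iff.1 h2

end Feature

/-! ### Densities with respect to the mixture -/

section Mixture

variable {X : Type*} [MeasurableSpace X] (P Q : Measure X)

instance [IsProbabilityMeasure P] [IsProbabilityMeasure Q] :
    IsProbabilityMeasure (mixture P Q) := by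
  constructor
  simp only [mixture, Measure.smul_apply, Measure.add_apply, measure_univ, smul_eq_mul]
  rw [one_add_one_eq_two]
  exact ENNReal.inv_mul_cancel two_ne_zero ENNReal.ofNat_ne_top

theorem two_smul_mixture : (2 : ℝ≥0∞) • mixture P Q = P + Q := by
  rw [mixture, smul_smul, ENNReal.mul_inv_cancel two_ne_zero ENNReal.ofNat_ne_top, one_smul]

theorem left_le_two_smul_mixture : P ≤ (2 : ℝ≥0∞) • mixture P Q := by
  rw [two_smul_mixture]; exact Measure.le_add_right le_rfl

theorem right_le_two_smul_mixture : Q ≤ (2 : ℝ≥0∞) • mixture P Q := by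
  rw [two_smul_mixture]; exact Measure.le_add_left le_rfl

theorem left_absolutelyContinuous_mixture : P ≪ mixture P Q :=
  Measure.absolutelyContinuous_of_le_smul (left_le_two_smul_mixture P Q)

theorem right_absolutelyContinuous_mixture : Q ≪ mixture P Q :=
  Measure.absolutelyContinuous_of_le_smul (right_le_two_smul_mixture P Q)

theorem rnDeriv_le_of_le_smul {μ ν : Measure X} [SigmaFinite μ] [SigmaFinite ν] {c : ℝ≥0∞}
    (h : μ ≤ c • ν) : μ.rnDeriv ν ≤ᵐ[ν] fun _ => c := by
  refine ae_le_of_forall_setLIntegral_le_of_sigmaFinite (Measure.measurable_rnDeriv _ _)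
    fun s _ _ => ?_
  calc ∫⁻ x in s, μ.rnDeriv ν x ∂ν ≤ μ s := Measure.setLIntegral_rnDeriv_le s
    _ ≤ (c • ν) s := h s
    _ = ∫⁻ _ in s, c ∂ν := by simp

/-- Both densities are bounded by `2`, so their difference is always square integrable. -/
theorem memLp_densityDiff [IsProbabilityMeasure P] [IsProbabilityMeasure Q] :
    MemLp (densityDiff P Q (mixture P Q)) 2 (mixture P Q) := by
  have hm : Measurable (densityDiff P Q (mixture P Q)) :=
    (Measure.measurable_rnDeriv _ _).ennreal_toReal.sub
      (Measure.measurable_rnDeriv _ _).ennreal_toReal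
  refine MemLp.of_bound hm.aestronglyMeasurable 2 ?_
  filter_upwards [rnDeriv_le_of_le_smul (left_le_two_smul_mixture P Q),
    rnDeriv_le_of_le_smul (right_le_two_smul_mixture P Q)] with x h1 h2
  have h1' := ENNReal.toReal_mono ENNReal.ofNat_ne_top h1
  have h2' := ENNReal.toReal_mono ENNReal.ofNat_ne_top h2
  have h1'' := ENNReal.toReal_nonneg (a := P.rnDeriv (mixture P Q) x)
  have h2'' := ENNReal.toReal_nonneg (a := Q.rnDeriv (mixture P Q) x)
  rw [ENNReal.toReal_ofNat] at h1' h2'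
  rw [densityDiff, Real.norm_eq_abs, abs_le]
  constructor <;> linarith

theorem integral_mixture {f : X → ℝ} (hP : Integrable f P) (hQ : Integrable f Q) :
    ∫ x, f x ∂(mixture P Q) = 2⁻¹ * (∫ x, f x ∂P + ∫ x, f x ∂Q) := by
  rw [mixture, integral_smul_measure, integral_add_measure hP hQ]
  simp

theorem integral_mul_densityDiff [IsProbabilityMeasure P] [IsProbabilityMeasure Q] {f : X → ℝ}
    (hP : Integrable f P) (hQ : Integrable f Q) :
    ∫ x, f x * densityDiff P Q (mixture P Q) x ∂(mixture P Q) = ∫ x, f x ∂P - ∫ x, f x ∂Q := by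
  have hPm := left_absolutelyContinuous_mixture P Q
  have hQm := right_absolutelyContinuous_mixture P Q
  rw [← integral_toReal_rnDeriv_mul hPm, ← integral_toReal_rnDeriv_mul hQm, ← integral_sub]
  · refine integral_congr_ae (.of_forall fun x => ?_)
    simp only [densityDiff]; ring
  · exact (integrable_rnDeriv_smul_iff hPm).2 hP
  · exact (integrable_rnDeriv_smul_iff hQm).2 hQ

end Mixture

/-! ### The inclusion into `L²` and the kernel embeddings -/

section Inclusion

variable {X : Type*} [MetricSpace X] [CompactSpace X] [MeasurableSpace X] [BorelSpace X]
  {H : Type*} [NormedAddCommGroup H] [InnerProductSpace ℝ H] [CompleteSpace H] [RKHS ℝ H X ℝ]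

theorem integrable_of_continuous {E : Type*} [NormedAddCommGroup E] (μ : Measure X)
    [IsFiniteMeasure μ] {f : X → E} (hf : Continuous f) : Integrable f μ :=
  hf.integrable_of_hasCompactSupport (.of_compactSpace f)

omit [CompactSpace X] [MeasurableSpace X] [BorelSpace X] in
theorem continuous_of_continuous_feature (hc : Continuous (feature H : X → H)) (f : H) :
    Continuous fun x : X => f x := by
  simp_rw [← inner_feature]
  fun_prop

/-- The inclusion of a reproducing kernel Hilbert space with continuous features into the space of
continuous functions on the compact base. -/
noncomputable def toContinuousMap (hc : Continuous (feature H : X → H)) : H →L[ℝ] C(X, ℝ) :=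
  LinearMap.mkContinuous
    { toFun := fun f => ⟨fun x => f x, continuous_of_continuous_feature hc f⟩
      map_add' := fun f g => by ext x; simp
      map_smul' := fun c f => by ext x; simp }
    ‖(⟨feature H, hc⟩ : C(X, H))‖ fun f => by
      rw [ContinuousMap.norm_le _ (by positivity)]
      intro x
      change ‖f x‖ ≤ _
      rw [← inner_feature, mul_comm]
      refine (norm_inner_le_norm _ _).trans ?_
      gcongr
      exact ContinuousMap.norm_coe_le_norm (⟨feature H, hc⟩ : C(X, H)) x

/-- The inclusion of a reproducing kernel Hilbert space into `L²(X, μ)`. -/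
noncomputable def toL2 (hc : Continuous (feature H : X → H)) (μ : Measure X) [IsFiniteMeasure μ] :
    H →L[ℝ] Lp ℝ 2 μ :=
  ContinuousMap.toLp 2 μ ℝ ∘L toContinuousMap hc

theorem coeFn_toL2 (hc : Continuous (feature H : X → H)) (μ : Measure X) [IsFiniteMeasure μ]
    (f : H) : toL2 hc μ f =ᵐ[μ] fun x => f x :=
  ContinuousMap.coeFn_toLp μ (toContinuousMap hc f)

theorem denseRange_toL2 (hc : Continuous (feature H : X → H)) (μ : Measure X) [IsFiniteMeasure μ]
    (huniv : IsL2Universal H μ) : DenseRange (toL2 hc μ) := by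
  have hdense := ContinuousMap.toLp_denseRange ℝ μ ℝ (p := 2) ENNReal.ofNat_ne_top
  rw [denseRange_iff_closure_range, ← Set.univ_subset_iff, ← hdense.closure_range]
  refine closure_minimal ?_ isClosed_closure
  rintro _ ⟨g, rfl⟩
  rw [EMetric.mem_closure_iff]
  intro ε hε
  obtain ⟨f, hf⟩ := huniv g ε hε
  refine ⟨_, ⟨f, rfl⟩, ?_⟩
  rw [edist_comm, Lp.edist_def]
  refine lt_of_eq_of_lt (eLpNorm_congr_ae ?_) hf
  filter_upwards [coeFn_toL2 hc μ f, ContinuousMap.coeFn_toLp (p := 2) (𝕜 := ℝ) μ g] with x h1 h2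
  rw [Pi.sub_apply, h1, h2]

variable (P Q : Measure X) [IsProbabilityMeasure P] [IsProbabilityMeasure Q]

theorem inner_meanEmbedding (hc : Continuous (feature H : X → H)) (f : H) :
    ⟪f, meanEmbedding H P⟫ = ∫ x, f x ∂P := by
  rw [meanEmbedding, ← integral_inner (integrable_of_continuous P hc)]
  simp_rw [inner_feature]

omit [CompactSpace X] [MeasurableSpace X] [BorelSpace X] in
theorem continuous_rankOne_feature (hc : Continuous (feature H : X → H)) :
    Continuous fun x : X => rankOne ℝ (feature H x) (feature H x) :=
  ((rankOne ℝ : H →L⋆[ℝ] H →L⋆[ℝ] H →L[ℝ] H).continuous.comp hc).clm_apply hc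

theorem inner_covEmbedding (hc : Continuous (feature H : X → H)) (f g : H) :
    ⟪f, covEmbedding H P g⟫ = ∫ x, f x * g x ∂P := by
  have hi := integrable_of_continuous P (continuous_rankOne_feature hc)
  rw [covEmbedding, ContinuousLinearMap.integral_apply hi,
    ← integral_inner (hi.apply_continuousLinearMap g)]
  refine integral_congr_ae (.of_forall fun x => ?_)
  simp only [rankOne_apply, inner_smul_right, inner_feature, inner_feature_left]
  ring

theorem inner_avgCov (hc : Continuous (feature H : X → H)) (f g : H) :
    ⟪f, avgCov H P Q g⟫ = ∫ x, f x * g x ∂(mixture P Q) := by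
  have hfg : Continuous fun x : X => f x * g x :=
    (continuous_of_continuous_feature hc f).mul (continuous_of_continuous_feature hc g)
  rw [integral_mixture P Q (integrable_of_continuous P hfg) (integrable_of_continuous Q hfg),
    ← inner_covEmbedding P hc, ← inner_covEmbedding Q hc, avgCov, smul_apply,
    add_apply, inner_smul_right, inner_add_right]

theorem avgCov_eq_adjoint_comp_toL2 (hc : Continuous (feature H : X → H)) :
    avgCov H P Q = (toL2 hc (mixture P Q)).adjoint ∘L toL2 hc (mixture P Q) := by
  ext1 g
  refine ext_inner_left ℝ fun f => ?_
  rw [inner_avgCov P Q hc, ContinuousLinearMap.comp_apply, ContinuousLinearMap.adjoint_inner_right,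
    L2.inner_def]
  refine integral_congr_ae ?_
  filter_upwards [coeFn_toL2 hc (mixture P Q) f, coeFn_toL2 hc (mixture P Q) g] with x h1 h2
  rw [h1, h2, real_inner_eq_re_inner, RCLike.inner_apply]
  simp [mul_comm]

theorem meanEmbedding_sub_eq_adjoint (hc : Continuous (feature H : X → H)) :
    meanEmbedding H P - meanEmbedding H Q =
      (toL2 hc (mixture P Q)).adjoint ((memLp_densityDiff P Q).toLp _) := by
  refine ext_inner_left ℝ fun f => ?_
  have hf := continuous_of_continuous_feature hc f
  rw [inner_sub_right, inner_meanEmbedding P hc, inner_meanEmbedding Q hc,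
    ← integral_mul_densityDiff P Q (integrable_of_continuous P hf) (integrable_of_continuous Q hf),
    ContinuousLinearMap.adjoint_inner_right, L2.inner_def]
  refine integral_congr_ae ?_
  filter_upwards [coeFn_toL2 hc (mixture P Q) f, (memLp_densityDiff P Q).coeFn_toLp] with x h1 h2
  rw [h1, h2, real_inner_eq_re_inner, RCLike.inner_apply]
  simp [mul_comm]

/-- The operator `S^{1/2}` is Hilbert-Schmidt: its Hilbert-Schmidt norm is bounded by Bessel's
inequality for the feature vectors. -/
theorem summable_norm_sq_sqrt_avgCov (hc : Continuous (feature H : X → H)) {R : H →L[ℝ] H}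
    (hR : IsNonnegSqrt R (avgCov H P Q)) {ι : Type*} {e : ι → H} (he : Orthonormal ℝ e) :
    Summable fun i => ‖R (e i)‖ ^ 2 := by
  refine summable_of_sum_le (c := ∫ x, ‖feature H x‖ ^ 2 ∂(mixture P Q)) (fun _ => by positivity)
    fun s => ?_
  have h1 : ∀ i, ‖R (e i)‖ ^ 2 = ∫ x, ⟪e i, feature H x⟫ ^ 2 ∂(mixture P Q) := fun i => by
    rw [← real_inner_self_eq_norm_sq, hR.1.inner_left_eq_inner_right,
      ← ContinuousLinearMap.comp_apply, hR.2, inner_avgCov P Q hc]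
    simp_rw [inner_feature, sq]
  simp_rw [h1]
  rw [← integral_finsetSum]
  · refine integral_mono (integrable_of_continuous _ (by fun_prop))
      (integrable_of_continuous _ (by fun_prop)) fun x => ?_
    have := he.sum_inner_products_le (x := feature H x) (s := s)
    simpa using this
  · exact fun i _ => integrable_of_continuous _ (by fun_prop)

end Inclusion

theorem countable_of_orthonormal {H : Type*} [NormedAddCommGroup H] [InnerProductSpace ℝ H]
    [TopologicalSpace.SeparableSpace H] {ι : Type*} {e : ι → H} (he : Orthonormal ℝ e) :
    Countable ι := by
  refine Pairwise.countable_of_isOpen_disjoint (s := fun i => Metric.ball (e i) 2⁻¹) ?_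
    (fun _ => Metric.isOpen_ball) (fun i => ⟨e i, Metric.mem_ball_self (by norm_num)⟩)
  intro i j hij
  refine Metric.ball_disjoint_ball ?_
  have h : ‖e i - e j‖ ^ 2 = 2 := by
    rw [norm_sub_sq_real, he.1, he.1, he.2 hij]
    norm_num
  rw [dist_eq_norm]
  nlinarith [norm_nonneg (e i - e j)]

/-! ### Gaussian measures and their characteristic functions -/

section CharFun

variable {H : Type*} [NormedAddCommGroup H] [InnerProductSpace ℝ H] [CompleteSpace H]
  [SecondCountableTopology H] [MeasurableSpace H] [BorelSpace H]

theorem isGaussianWith_of_charFun {μ : Measure H} [IsFiniteMeasure μ] {m : H} {S : H →L[ℝ] H}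
    (hS : S.IsPositive)
    (h : ∀ t, charFun μ t = Complex.exp (⟪t, m⟫ * Complex.I - (⟪t, S t⟫ : ℝ) / 2)) :
    IsGaussianWith μ m S := by
  let f : H →L[ℝ] H →L[ℝ] ℝ :=
    (innerSL ℝ : H →L[ℝ] H →L[ℝ] ℝ).bilinearComp (.id ℝ H) S
  have hf : ∀ x y, f x y = ⟪x, S y⟫ := fun x y => rfl
  have hpos : f.toBilinForm.IsPosSemidef :=
    ⟨⟨fun x y => by
      change f x y = f y x
      rw [hf, hf, ← hS.inner_left_eq_inner_right, real_inner_comm]⟩,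
      ⟨fun x => hS.inner_nonneg_right x⟩⟩
  have hch : ∀ t, charFun μ t = Complex.exp (⟪t, m⟫ * Complex.I - f t t / 2) := h
  obtain ⟨h1, h2⟩ := gaussian_charFun_congr m f hpos hch
  exact ⟨isGaussian_iff_gaussian_charFun.2 ⟨m, f, hpos, hch⟩, h1.symm,
    fun x y => by rw [← h2, hf]⟩

theorem IsGaussianWith.charFun_eq {μ : Measure H} {m : H} {S : H →L[ℝ] H}
    (h : IsGaussianWith μ m S) (t : H) :
    charFun μ t = Complex.exp (⟪t, m⟫ * Complex.I - (⟪t, S t⟫ : ℝ) / 2) := by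
  have := h.isGaussian
  rw [IsGaussian.charFun_eq', h.cov]
  simp only [id_eq, h.mean]

theorem IsGaussianWith.eq_gaussianMeasure {μ : Measure H} {m : H} {S : H →L[ℝ] H}
    (h : IsGaussianWith μ m S) : gaussianMeasure m S = μ := by
  have hex : ∃ μ : Measure H, IsGaussianWith μ m S := ⟨μ, h⟩
  rw [gaussianMeasure, dif_pos hex]
  exact hex.choose_spec.unique h

/-- Adding an independent one-dimensional Gaussian variable along the vector `w` shifts the mean
along `w` and adds `w ⊗ w` to the covariance. -/
theorem IsGaussianWith.map_prod {ν : Measure H} {S : H →L[ℝ] H} (hν : IsGaussianWith ν 0 S)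
    (hS : S.IsPositive) (m w : H) (c : ℝ) :
    IsGaussianWith (((gaussianReal c 1).prod ν).map fun p : ℝ × H => m + (p.1 • w + p.2))
      (m + c • w) (S + rankOne ℝ w w) := by
  have := hν.isGaussian
  have hmeas : Measurable fun p : ℝ × H => m + (p.1 • w + p.2) := by fun_prop
  have : IsProbabilityMeasure
      (((gaussianReal c 1).prod ν).map fun p : ℝ × H => m + (p.1 • w + p.2)) :=
    Measure.isProbabilityMeasure_map hmeas.aemeasurable
  refine isGaussianWith_of_charFun (hS.add ?_) fun t => ?_
  · exact InnerProductSpace.isPositive_rankOne_self w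
  rw [charFun_apply, integral_map hmeas.aemeasurable (by fun_prop)]
  have hsplit : ∀ p : ℝ × H, Complex.exp ((⟪m + (p.1 • w + p.2), t⟫ : ℝ) * Complex.I) =
      Complex.exp ((⟪m, t⟫ : ℝ) * Complex.I) *
        (Complex.exp ((⟪w, t⟫ : ℝ) * (p.1 : ℂ) * Complex.I) *
          Complex.exp ((⟪p.2, t⟫ : ℝ) * Complex.I)) := fun p => by
    rw [← Complex.exp_add, ← Complex.exp_add, inner_add_left, inner_add_left, inner_smul_left]
    congr 1
    push_cast
    simp
    ring
  simp_rw [hsplit]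
  rw [integral_const_mul, integral_prod_mul
    (f := fun x : ℝ => Complex.exp ((⟪w, t⟫ : ℝ) * (x : ℂ) * Complex.I))
    (g := fun y : H => Complex.exp ((⟪y, t⟫ : ℝ) * Complex.I)), ← charFun_apply_real,
    ← charFun_apply, charFun_gaussianReal, hν.charFun_eq, ← Complex.exp_add, ← Complex.exp_add]
  congr 1
  rw [inner_zero_right, add_apply, inner_add_right, rankOne_apply,
    inner_smul_right, inner_add_right, inner_smul_right, real_inner_comm t w, real_inner_comm t m]
  push_cast
  ring

/-- Shifting a Gaussian measure along `w` does not change its null sets when `w ⊗ w` can be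
split off from the covariance: only the one-dimensional factor along `w` is changed. -/
theorem IsGaussianWith.gaussianMeasure_add_smul_absolutelyContinuous {ν : Measure H}
    {S : H →L[ℝ] H} (hν : IsGaussianWith ν 0 S) (hS : S.IsPositive) (m w : H) (c d : ℝ) :
    gaussianMeasure (m + c • w) (S + rankOne ℝ w w) ≪
      gaussianMeasure (m + d • w) (S + rankOne ℝ w w) := by
  have := hν.isGaussian
  rw [(hν.map_prod hS m w c).eq_gaussianMeasure, (hν.map_prod hS m w d).eq_gaussianMeasure]
  refine Measure.AbsolutelyContinuous.map ?_ (by fun_prop)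
  exact ((gaussianReal_absolutelyContinuous c one_ne_zero).trans
    (gaussianReal_absolutelyContinuous' d one_ne_zero)).prod .rfl

end CharFun

/-! ### Random series with Gaussian coefficients -/

section Series

variable {ι : Type*}

/-- The law of a family of independent standard Gaussian variables. -/
noncomputable def whiteNoise (ι : Type*) : Measure (ι → ℝ) :=
  Measure.infinitePi fun _ => gaussianReal 0 1

instance : IsProbabilityMeasure (whiteNoise ι) := by unfold whiteNoise; infer_instance

theorem measurePreserving_eval_whiteNoise (i : ι) :
    MeasurePreserving (fun ω : ι → ℝ => ω i) (whiteNoise ι) (gaussianReal 0 1) :=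
  measurePreserving_eval_infinitePi _ i

theorem memLp_eval_whiteNoise (i : ι) : MemLp (fun ω : ι → ℝ => ω i) 2 (whiteNoise ι) :=
  (memLp_id_gaussianReal (μ := 0) (v := 1) 2).comp_measurePreserving
    (measurePreserving_eval_whiteNoise i)

theorem iIndepFun_eval_whiteNoise :
    iIndepFun (fun (i : ι) (ω : ι → ℝ) => ω i) (whiteNoise ι) :=
  iIndepFun_infinitePi (X := fun _ x => x) fun _ => measurable_id

theorem integral_eval_whiteNoise (i : ι) : ∫ ω, ω i ∂(whiteNoise ι) = 0 := by
  rw [← integral_id_gaussianReal (μ := 0) (v := 1),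
    ← (measurePreserving_eval_whiteNoise i).map_eq,
    integral_map (measurable_pi_apply i).aemeasurable (by fun_prop)]

theorem integral_sq_eval_whiteNoise (i : ι) : ∫ ω, ω i * ω i ∂(whiteNoise ι) = 1 := by
  have h1 : ∫ x, x * x ∂(gaussianReal 0 1) = 1 := by
    have := variance_fun_id_gaussianReal (μ := 0) (v := 1)
    rw [variance_of_integral_eq_zero (by fun_prop) (by simp)] at this
    simpa [sq] using this
  rw [← h1, ← (measurePreserving_eval_whiteNoise i).map_eq,
    integral_map (measurable_pi_apply i).aemeasurable (by fun_prop)]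

theorem integral_mul_eval_whiteNoise {i j : ι} (hij : i ≠ j) :
    ∫ ω, ω i * ω j ∂(whiteNoise ι) = 0 := by
  have h := (iIndepFun_eval_whiteNoise (ι := ι)).indepFun hij
  rw [h.integral_fun_mul_eq_mul_integral
    (measurable_pi_apply i).aestronglyMeasurable (measurable_pi_apply j).aestronglyMeasurable,
    integral_eval_whiteNoise, zero_mul]

variable {H : Type*} [NormedAddCommGroup H] [InnerProductSpace ℝ H]

theorem memLp_eval_smul (i : ι) (v : H) :
    MemLp (fun ω : ι → ℝ => ω i • v) 2 (whiteNoise ι) :=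
  by
  refine (memLp_eval_whiteNoise i).of_le_mul (c := ‖v‖)
    ((memLp_eval_whiteNoise i).aestronglyMeasurable.smul_const v) (.of_forall fun ω => ?_)
  rw [norm_smul, mul_comm]

theorem inner_toLp_eval_smul (i j : ι) (v w : H) :
    ⟪(memLp_eval_smul i v).toLp, (memLp_eval_smul j w).toLp⟫ =
      (∫ ω, ω i * ω j ∂(whiteNoise ι)) * ⟪v, w⟫ := by
  rw [L2.inner_def, ← integral_mul_const]
  refine integral_congr_ae ?_
  filter_upwards [(memLp_eval_smul i v).coeFn_toLp, (memLp_eval_smul j w).coeFn_toLp] with ω h1 h2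
  rw [h1, h2, real_inner_smul_left, real_inner_smul_right]
  ring

/-- The isometric embedding `v ↦ ξᵢ v` of `H` into the `H`-valued random variables, where `ξᵢ` is
the `i`-th coordinate of the white noise. -/
noncomputable def noiseEmbedding (i : ι) : H →ₗᵢ[ℝ] Lp H 2 (whiteNoise ι) where
  toFun v := (memLp_eval_smul i v).toLp
  map_add' v w := by
    rw [← MemLp.toLp_add]
    exact MemLp.toLp_congr _ _ (.of_forall fun ω => smul_add _ _ _)
  map_smul' c v := by
    rw [RingHom.id_apply, ← MemLp.toLp_const_smul]
    exact MemLp.toLp_congr _ _ (.of_forall fun ω => smul_comm _ _ _)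
  norm_map' v := by
    change ‖(memLp_eval_smul i v).toLp‖ = ‖v‖
    rw [← sq_eq_sq₀ (norm_nonneg _) (norm_nonneg _), ← real_inner_self_eq_norm_sq,
      inner_toLp_eval_smul, integral_sq_eval_whiteNoise, one_mul, real_inner_self_eq_norm_sq]

theorem orthogonalFamily_noiseEmbedding :
    OrthogonalFamily ℝ (fun _ : ι => H) (fun i => noiseEmbedding i) := by
  intro i j hij v w
  change ⟪(memLp_eval_smul i v).toLp, (memLp_eval_smul j w).toLp⟫ = 0
  rw [inner_toLp_eval_smul, integral_mul_eval_whiteNoise hij, zero_mul]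

variable [CompleteSpace H] [SecondCountableTopology H] [MeasurableSpace H] [BorelSpace H]

omit [CompleteSpace H] [SecondCountableTopology H] in
theorem measurable_eval_smul (i : ι) (v : H) : Measurable fun ω : ι → ℝ => ω i • v :=
  (continuous_id.smul continuous_const).measurable.comp (measurable_pi_apply i)

omit [CompleteSpace H] in
theorem charFun_map_sum_eval_smul (s : Finset ι) (v : ι → H) (t : H) :
    charFun ((whiteNoise ι).map fun ω => ∑ i ∈ s, ω i • v i) t =
      Complex.exp (-((∑ i ∈ s, ⟪t, v i⟫ ^ 2 : ℝ) / 2 : ℂ)) := by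
  have hind : iIndepFun (fun i (ω : ι → ℝ) => ω i • v i) (whiteNoise ι) :=
    iIndepFun_eval_whiteNoise.comp (fun i x => x • v i) fun i => by fun_prop
  rw [(hind.restrict s).charFun_map_fun_finsetSum_eq_prod
    (fun i _ => (measurable_eval_smul i (v i)).aemeasurable),
    Finset.prod_apply]
  have h1 : ∀ i, charFun ((whiteNoise ι).map fun ω => ω i • v i) t =
      Complex.exp (-((⟪t, v i⟫ ^ 2 : ℝ) / 2 : ℂ)) := fun i => by
    have h2 : charFun (gaussianReal 0 1) ⟪v i, t⟫ =
        Complex.exp (-((⟪t, v i⟫ ^ 2 : ℝ) / 2 : ℂ)) := by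
      rw [charFun_gaussianReal, real_inner_comm]
      congr 1
      push_cast
      ring
    rw [← h2, charFun_apply, charFun_apply_real, ← (measurePreserving_eval_whiteNoise i).map_eq,
      integral_map (measurable_eval_smul i (v i)).aemeasurable (by fun_prop),
      integral_map (measurable_pi_apply i).aemeasurable (by fun_prop)]
    refine integral_congr_ae (.of_forall fun ω => ?_)
    simp only [real_inner_smul_left]
    push_cast
    ring_nf
  simp_rw [h1]
  rw [← Complex.exp_sum]
  congr 1
  push_cast
  rw [Finset.sum_neg_distrib, Finset.sum_div]

/-- The law of the random series `∑ ξᵢ vᵢ` with independent standard Gaussian coefficients, which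
converges in `L²` when `∑ ‖vᵢ‖² < ∞`, is the centred Gaussian measure with covariance
`∑ vᵢ ⊗ vᵢ`. -/
theorem exists_isGaussianWith_of_hasSum [Countable ι] {v : ι → H}
    (hv : Summable fun i => ‖v i‖ ^ 2) {S : H →L[ℝ] H} (hS : S.IsPositive)
    (hsum : ∀ t, HasSum (fun i => ⟪t, v i⟫ ^ 2) ⟪t, S t⟫) :
    ∃ μ : Measure H, IsGaussianWith μ 0 S := by
  obtain ⟨Z, hZ⟩ :=
    ((orthogonalFamily_noiseEmbedding (H := H) (ι := ι)).summable_iff_norm_sq_summable v).2 hv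
  have hsumae : ∀ s : Finset ι,
      (fun ω => (∑ i ∈ s, noiseEmbedding i (v i) : Lp H 2 (whiteNoise ι)) ω)
      =ᵐ[whiteNoise ι] fun ω => ∑ i ∈ s, ω i • v i := fun s => by
    have h1 : ∀ i, noiseEmbedding i (v i) =ᵐ[whiteNoise ι] fun ω : ι → ℝ => ω i • v i :=
      fun i => (memLp_eval_smul i (v i)).coeFn_toLp
    filter_upwards [Lp.coeFn_finsetSum s fun i => noiseEmbedding i (v i),
      ae_all_iff.2 h1] with ω h2 h3
    rw [h2, Finset.sum_apply]
    exact Finset.sum_congr rfl fun i _ => h3 i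
  have hmeas : TendstoInMeasure (whiteNoise ι) (fun (s : Finset ι) ω => ∑ i ∈ s, ω i • v i)
      Filter.atTop Z := (tendstoInMeasure_of_tendsto_Lp hZ).congr_left hsumae
  have hdist := hmeas.tendstoInDistribution fun s =>
    (Finset.measurable_fun_sum s fun i _ => measurable_eval_smul i (v i)).aemeasurable
  have hZm : AEMeasurable Z (whiteNoise ι) := (Lp.aestronglyMeasurable Z).aemeasurable
  have : IsProbabilityMeasure ((whiteNoise ι).map Z) := Measure.isProbabilityMeasure_map hZm
  refine ⟨(whiteNoise ι).map Z, isGaussianWith_of_charFun hS fun t => ?_⟩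
  have hlim := (ProbabilityMeasure.tendsto_iff_forall_integral_rclike_tendsto ℂ).1 hdist.tendsto
    (BoundedContinuousFunction.innerProbChar t)
  simp only [ProbabilityMeasure.coe_mk, ← charFun_eq_integral_innerProbChar] at hlim
  refine tendsto_nhds_unique hlim ?_
  simp_rw [charFun_map_sum_eval_smul]
  rw [inner_zero_right, Complex.ofReal_zero, zero_mul, zero_sub]
  exact (Complex.continuous_exp.tendsto _).comp
    (((Complex.continuous_ofReal.tendsto _).comp (hsum t)).div_const 2).neg

/-- A Hilbert-Schmidt operator `B` gives rise to the centred Gaussian measure with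
covariance `B B†`. -/
theorem exists_isGaussianWith_comp_adjoint {ι : Type*} (b : HilbertBasis ι ℝ H) {B : H →L[ℝ] H}
    (hB : Summable fun i => ‖B (b i)‖ ^ 2) :
    ∃ μ : Measure H, IsGaussianWith μ 0 (B ∘L B.adjoint) := by
  have := countable_of_orthonormal b.orthonormal
  refine exists_isGaussianWith_of_hasSum hB
    (ContinuousLinearMap.isPositive_self_comp_adjoint B) fun t => ?_
  have h := b.hasSum_inner_mul_inner (B.adjoint t) (B.adjoint t)
  rw [ContinuousLinearMap.adjoint_inner_left] at h
  refine h.congr_fun fun i => ?_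
  rw [sq, ContinuousLinearMap.adjoint_inner_left, ContinuousLinearMap.adjoint_inner_right,
    real_inner_comm t]

end Series

/-! ### Shifts of Gaussian measures -/

section CameronMartin

variable {H : Type*} [NormedAddCommGroup H] [InnerProductSpace ℝ H] [CompleteSpace H]
  [SecondCountableTopology H] [MeasurableSpace H] [BorelSpace H]

omit [SecondCountableTopology H] [MeasurableSpace H] [BorelSpace H] in
/-- With `e` a unit vector, `R - R e ⊗ e` is `R` composed with the projection onto `eᗮ`, so the
rank-one operator `R e ⊗ R e` is split off from `S = R²` with a positive remainder. For `e = 0`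
there is nothing to split off. -/
theorem comp_adjoint_sub_rankOne_add {R S : H →L[ℝ] H} (hR : IsNonnegSqrt R S) {e : H}
    (he : e = 0 ∨ ‖e‖ = 1) :
    (R - rankOne ℝ (R e) e) ∘L (R - rankOne ℝ (R e) e).adjoint + rankOne ℝ (R e) (R e) = S := by
  have hadj : R.adjoint = R := hR.1.isSelfAdjoint.adjoint_eq
  have hee : R e = 0 ∨ ⟪e, e⟫ = 1 := by
    rcases he with rfl | he
    · exact .inl (map_zero R)
    · right; rw [real_inner_self_eq_norm_sq, he, one_pow]
  rw [map_sub, hadj, adjoint_rankOne, ← hR.2]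
  ext1 t
  simp only [add_apply, sub_apply, ContinuousLinearMap.comp_apply, rankOne_apply, map_sub,
    map_smul, hR.1.inner_left_eq_inner_right]
  rcases hee with h | h
  · simp [h]
  · rw [h]
    module

/-- The Gaussian measure `N(m, S)` exists when the square root of `S` is Hilbert-Schmidt. -/
theorem isGaussianWith_gaussianMeasure {ι : Type*} (b : HilbertBasis ι ℝ H) {R S : H →L[ℝ] H}
    (hR : IsNonnegSqrt R S) (hHS : Summable fun i => ‖R (b i)‖ ^ 2) (m : H) :
    IsGaussianWith (gaussianMeasure m S) m S := by
  obtain ⟨μ, hμ⟩ := exists_isGaussianWith_comp_adjoint b hHS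
  have hS : R ∘L R.adjoint = S := by rw [hR.1.isSelfAdjoint.adjoint_eq, hR.2]
  -- translation by `m` is the case `w = 0` of adding an independent Gaussian multiple of `w`
  have h := hμ.map_prod (ContinuousLinearMap.isPositive_self_comp_adjoint R) m 0 0
  rw [hS, smul_zero, add_zero, map_zero, add_zero] at h
  rwa [h.eq_gaussianMeasure]

/-- The sufficient direction of the Cameron-Martin theorem: shifting the mean within the range of
`S^{1/2}` preserves null sets. If the shift is `S^{1/2} u` with `u = ‖u‖ e`, then
`S^{1/2} e ⊗ S^{1/2} e` splits off from `S`, and the shift only moves the corresponding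
one-dimensional factor. -/
theorem gaussianMeasure_absolutelyContinuous_of_sub_eq {ι : Type*} (b : HilbertBasis ι ℝ H)
    {R S : H →L[ℝ] H} (hR : IsNonnegSqrt R S) (hHS : Summable fun i => ‖R (b i)‖ ^ 2)
    {m₁ m₂ u : H} (hu : m₁ - m₂ = R u) :
    gaussianMeasure m₁ S ≪ gaussianMeasure m₂ S := by
  -- for `u = 0` this is `e = 0`, and the argument degenerates correctly
  set e := ‖u‖⁻¹ • u with he_def
  have he : e = 0 ∨ ‖e‖ = 1 := by
    rcases eq_or_ne u 0 with h | h
    · left; rw [he_def, h, smul_zero]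
    · right; rw [he_def, norm_smul, norm_inv, norm_norm, inv_mul_cancel₀ (norm_ne_zero_iff.2 h)]
  have hue : u = ‖u‖ • e := by
    rcases eq_or_ne u 0 with h | h
    · simp [h]
    · rw [he_def, smul_smul, mul_inv_cancel₀ (norm_ne_zero_iff.2 h), one_smul]
  have hB : Summable fun i => ‖(R - rankOne ℝ (R e) e) (b i)‖ ^ 2 := by
    refine .of_nonneg_of_le (fun _ => by positivity) (fun i => ?_)
      ((hHS.mul_left 2).add ((b.orthonormal.inner_products_summable (x := e)).mul_left
        (2 * ‖R e‖ ^ 2)))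
    rw [sub_apply, rankOne_apply]
    have h1 : ‖R (b i) - ⟪e, b i⟫ • R e‖ ≤ ‖R (b i)‖ + ‖⟪b i, e⟫‖ * ‖R e‖ := by
      rw [real_inner_comm, ← norm_smul]
      exact norm_sub_le _ _
    calc ‖R (b i) - ⟪e, b i⟫ • R e‖ ^ 2 ≤ (‖R (b i)‖ + ‖⟪b i, e⟫‖ * ‖R e‖) ^ 2 := by gcongr
      _ ≤ 2 * (‖R (b i)‖ ^ 2 + (‖⟪b i, e⟫‖ * ‖R e‖) ^ 2) := add_sq_le
      _ = 2 * ‖R (b i)‖ ^ 2 + 2 * ‖R e‖ ^ 2 * ‖⟪b i, e⟫‖ ^ 2 := by ring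
  obtain ⟨ν, hν⟩ := exists_isGaussianWith_comp_adjoint b hB
  have h := hν.gaussianMeasure_add_smul_absolutelyContinuous
    (ContinuousLinearMap.isPositive_self_comp_adjoint _) m₂ (R e) ‖u‖ 0
  rwa [comp_adjoint_sub_rankOne_add hR he, zero_smul, add_zero, ← map_smul, ← hue, ← hu,
    add_sub_cancel] at h

end CameronMartin

end KernelGaussian

open KernelGaussian in
theorem proposition1
    {X : Type*} [MetricSpace X] [CompactSpace X] [MeasurableSpace X] [BorelSpace X]
    (k : X → X → ℝ) (hk : Continuous fun p : X × X => k p.1 p.2)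
    -- `H` is the reproducing kernel Hilbert space of `k`
    {H : Type*} [NormedAddCommGroup H] [InnerProductSpace ℝ H] [CompleteSpace H]
    [RKHS ℝ H X ℝ] (hH : ∀ x y : X, feature H y x = k x y)
    [MeasurableSpace H] [BorelSpace H]
    (P Q : Measure X) [IsProbabilityMeasure P] [IsProbabilityMeasure Q]
    (huniv : IsL2Universal H (mixture P Q)) :
    -- the two Gaussian measures and the square root of the covariance exist
    IsGaussianWith (gaussianMeasure (meanEmbedding H P) (avgCov H P Q))
      (meanEmbedding H P) (avgCov H P Q) ∧
    IsGaussianWith (gaussianMeasure (meanEmbedding H Q) (avgCov H P Q))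
      (meanEmbedding H Q) (avgCov H P Q) ∧
    IsNonnegSqrt (opSqrt (avgCov H P Q)) (avgCov H P Q) ∧
    -- equivalence of the Gaussian measures
    ((gaussianMeasure (meanEmbedding H P) (avgCov H P Q) ≪
          gaussianMeasure (meanEmbedding H Q) (avgCov H P Q) ∧
        gaussianMeasure (meanEmbedding H Q) (avgCov H P Q) ≪
          gaussianMeasure (meanEmbedding H P) (avgCov H P Q)) ↔
      MemLp (densityDiff P Q (mixture P Q)) 2 (mixture P Q)) ∧
    -- the Mahalanobis distance of the means
    mahalanobisNorm (avgCov H P Q) (meanEmbedding H P - meanEmbedding H Q) =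
      eLpNorm (densityDiff P Q (mixture P Q)) 2 (mixture P Q) ∧
    -- the mean component does not produce singularity, whatever `P` and `Q` are
    ¬ (gaussianMeasure (meanEmbedding H P) (avgCov H P Q) ⟂ₘ
        gaussianMeasure (meanEmbedding H Q) (avgCov H P Q)) := by
  have hc : Continuous (feature H : X → H) := continuous_feature hk hH
  have := separableSpace_of_continuous_feature hc
  have := UniformSpace.secondCountable_of_separable H
  set A := toL2 hc (mixture P Q)
  have hS : avgCov H P Q = A.adjoint ∘L A := avgCov_eq_adjoint_comp_toL2 P Q hc
  have hR : IsNonnegSqrt (opSqrt (avgCov H P Q)) (avgCov H P Q) :=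
    isNonnegSqrt_opSqrt (hS ▸ exists_isNonnegSqrt_adjoint_comp_self A)
  obtain ⟨s, b, -⟩ := exists_hilbertBasis ℝ H
  have hHS := summable_norm_sq_sqrt_avgCov P Q hc hR b.orthonormal
  have hL2 := memLp_densityDiff P Q
  obtain ⟨u, hu, hRu, hnorm⟩ : ∃ u ∈ (LinearMap.ker (opSqrt (avgCov H P Q)).toLinearMap)ᗮ,
      opSqrt (avgCov H P Q) u = meanEmbedding H P - meanEmbedding H Q ∧ ‖u‖ = ‖hL2.toLp‖ := by
    rw [meanEmbedding_sub_eq_adjoint P Q hc]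
    exact IsNonnegSqrt.exists_apply_eq_adjoint (A := A) (by rwa [← hS])
      (denseRange_toL2 hc _ huniv) _
  have hGP := isGaussianWith_gaussianMeasure b hR hHS (meanEmbedding H P)
  have hGQ := isGaussianWith_gaussianMeasure b hR hHS (meanEmbedding H Q)
  have hPQ := gaussianMeasure_absolutelyContinuous_of_sub_eq b hR hHS hRu.symm
  have hQP := gaussianMeasure_absolutelyContinuous_of_sub_eq b hR hHS
    (m₁ := meanEmbedding H Q) (m₂ := meanEmbedding H P) (u := -u)
    (by rw [map_neg, hRu, neg_sub])
  refine ⟨hGP, hGQ, hR, ⟨fun _ => hL2, fun _ => ⟨hPQ, hQP⟩⟩, ?_, fun hsing => ?_⟩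
  · rw [mahalanobisNorm_eq hu hRu, ← ofReal_norm, hnorm, Lp.norm_toLp,
      ENNReal.ofReal_toReal hL2.eLpNorm_ne_top]
  · have := hGP.isGaussian
    exact IsProbabilityMeasure.ne_zero _
      (Measure.eq_zero_of_absolutelyContinuous_of_mutuallySingular hPQ hsing)
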